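/- **Theorem.** Consider the hard-constraint size-stochastic knapsack problem: items $1,\dots,n$ arrive in this order at a knapsack of capacity $1$; their sizes $S_1,\dots,S_n$ are independent random variables with known distributions $F_1,\dots,F_n$ on $[0,1]$, and $\sum_{i=1}^n\mathbb{E}[S_i]\le 1$. When item $i$ arrives, a policy either discards it or tries to insert it, without knowing $S_i$. Let $W_i$ be the usage of the knapsack just before item $i$ is processed, so $W_1=0$, $W_{i+1}=W_i+S_i$ if item $i$ is tried, and $W_{i+1}=W_i$ otherwise. A tried item is accepted if $W_i+S_i\le 1$; if $W_i+S_i>1$, it is rejected, the usage exceeds $1$ from then on, and no later item is tried. For $\gamma>0$, the $\gamma$-aggressive policy treats item $i$ with a threshold $\theta_i$ and a probability $q_i\in[0,1]$, using independent coins: if $\theta_i<W_i\le 1$, it tries item $i$; if $W_i=\theta_i$, it tries item $i$ with probability $q_i$; otherwise it discards item $i$. Here $$\theta_i=\inf\Theta_i,\qquad \Theta_i=\{\theta\in[0,1] : \Pr[\theta\le W_i\le 1-S_i]\ge\gamma\},\qquad q_i=\frac{\gamma-\Pr[\theta_i<W_i\le 1-S_i]}{\Pr[\theta_i=W_i\le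 1-S_i]},$$ where $q_i\in[0,1]$ is arbitrary if the denominator is $0$. Such parameters exist for item $i$ if $\Theta_i\neq\emptyset$ and, when the denominator is nonzero, the quotient lies in $[0,1]$. The policy is *feasible* if such $\theta_i$ and $q_i$ exist for every item $i$. For every $\gamma\in(0,1/3]$ and every instance, the $\gamma$-aggressive policy is feasible: such parameters exist for all items, and, whatever admissible parameters were used for items $1,\dots,i-1$, admissible parameters exist for item $i$. Moreover, with any such parameters every item is accepted with probability exactly $\gamma$. The same holds if $\theta_i=\sup\Theta_i$ is used throughout in place of $\theta_i=\inf\Theta_i$. -/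

import Mathlib

open MeasureTheory ProbabilityTheory Set

noncomputable section

namespace KOCRS

/-- An instance of the knapsack problem with `n` items arriving in the order `0, 1, …, n - 1`:
size distributions `F i` on `[0,1]` with total expected size at most the capacity `1`. -/
structure IsInstance {n : ℕ} (F : Fin n → Measure ℝ) : Prop where
  isProbabilityMeasure : ∀ i, IsProbabilityMeasure (F i)
  size_mem : ∀ i, ∀ᵐ s ∂F i, s ∈ Icc (0 : ℝ) 1
  sum_mean_le : ∑ i, ∫ s, s ∂F i ≤ 1

/-- The randomness of a run: sizes `S i` with law `F i` and internal coins `C i` of the policy,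
uniform on `[0,1]`, all of them mutually independent. -/
structure IsRealization {n : ℕ} {Ω : Type*} [MeasurableSpace Ω] (μ : Measure Ω)
    (F : Fin n → Measure ℝ) (S C : Fin n → Ω → ℝ) : Prop where
  measurable_size : ∀ i, Measurable (S i)
  measurable_coin : ∀ i, Measurable (C i)
  map_size : ∀ i, μ.map (S i) = F i
  map_coin : ∀ i, μ.map (C i) = volume.restrict (Icc (0 : ℝ) 1)
  indep : iIndepFun (Sum.elim S C) μ

/-- The decision to try to insert an item, given the current usage `w`, the threshold `t`, the
tie-breaking probability `p` and the coin `c`.  A usage `w > 1` records that a critical item has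
already overflowed the knapsack; nothing is tried any more after that. -/
def Tries (t p w c : ℝ) : Prop :=
  w ≤ 1 ∧ (t < w ∨ (w = t ∧ c ≤ p))

open Classical in
/-- `usage θ q S C i.castSucc` is the usage `W_i` of the knapsack just before item `i` is processed
and `usage θ q S C i.succ` the usage just after it, for the threshold policy with thresholds `θ` and
tie-breaking probabilities `q`.  The size of a critical (overflowing) item is counted, so that the
usage exceeds `1` from then on. -/
def usage {n : ℕ} {Ω : Type*} (θ q : Fin n → ℝ) (S C : Fin n → Ω → ℝ) :
    Fin (n + 1) → Ω → ℝ :=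
  Fin.induction (motive := fun _ => Ω → ℝ) (fun _ => 0)
    (fun i W ω => if Tries (θ i) (q i) (W ω) (C i ω) then W ω + S i ω else W ω)

/-- Item `i` is accepted under the hard constraint: it is tried and it fits. -/
def accepted {n : ℕ} {Ω : Type*} (θ q : Fin n → ℝ) (S C : Fin n → Ω → ℝ) (i : Fin n) : Set Ω :=
  {ω | Tries (θ i) (q i) (usage θ q S C i.castSucc ω) (C i ω) ∧
    usage θ q S C i.castSucc ω + S i ω ≤ 1}

/-- The set `{θ ∈ [0,1] | Pr[θ ≤ W ≤ 1 - S] ≥ γ}`. -/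
def thresholdSet {Ω : Type*} [MeasurableSpace Ω] (μ : Measure Ω) (γ : ℝ) (W S : Ω → ℝ) : Set ℝ :=
  {t | t ∈ Icc (0 : ℝ) 1 ∧ γ ≤ μ.real {ω | t ≤ W ω ∧ W ω ≤ 1 - S ω}}

/-- `t` and `p` are a threshold and a tie-breaking probability that the `γ`-aggressive policy may
use for an item of size `S` that meets the usage `W`: `t` is the extremum `opt` (infimum or
supremum) of the nonempty set `thresholdSet μ γ W S`, and `p ∈ [0,1]` equals
`(γ - Pr[t < W ≤ 1 - S]) / Pr[t = W ≤ 1 - S]`, being arbitrary in `[0,1]` if the denominator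
vanishes. -/
structure IsAggressiveChoice {Ω : Type*} [MeasurableSpace Ω] (opt : Set ℝ → ℝ) (μ : Measure Ω)
    (γ : ℝ) (W S : Ω → ℝ) (t p : ℝ) : Prop where
  nonempty : (thresholdSet μ γ W S).Nonempty
  threshold_eq : t = opt (thresholdSet μ γ W S)
  prob_mem : p ∈ Icc (0 : ℝ) 1
  prob_eq : μ.real {ω | t = W ω ∧ W ω ≤ 1 - S ω} ≠ 0 →
    p = (γ - μ.real {ω | t < W ω ∧ W ω ≤ 1 - S ω}) / μ.real {ω | t = W ω ∧ W ω ≤ 1 - S ω}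

/-- The parameters `θ`, `q` follow the rule of the `γ`-aggressive policy for item `i`. -/
def FollowsAt {n : ℕ} {Ω : Type*} [MeasurableSpace Ω] (opt : Set ℝ → ℝ) (μ : Measure Ω)
    (γ : ℝ) (S C : Fin n → Ω → ℝ) (θ q : Fin n → ℝ) (i : Fin n) : Prop :=
  IsAggressiveChoice opt μ γ (usage θ q S C i.castSucc) (S i) (θ i) (q i)

/-- The `γ`-aggressive policy is feasible: suitable thresholds and tie-breaking probabilities exist
for every item.  Moreover the policy never gets stuck, whatever admissible parameters
were used for the earlier items. -/
structure Feasible {n : ℕ} {Ω : Type*} [MeasurableSpace Ω] (opt : Set ℝ → ℝ) (μ : Measure Ω)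
    (γ : ℝ) (S C : Fin n → Ω → ℝ) : Prop where
  exists_params : ∃ θ q : Fin n → ℝ, ∀ i, FollowsAt opt μ γ S C θ q i
  never_stuck : ∀ (θ q : Fin n → ℝ) (i : Fin n), (∀ j < i, FollowsAt opt μ γ S C θ q j) →
    ∃ t p : ℝ, IsAggressiveChoice opt μ γ (usage θ q S C i.castSucc) (S i) t p

end KOCRS

end

namespace KOCRS

open Filter

variable {Ω : Type*} [MeasurableSpace Ω]

/-! Induct on the items, keeping two bounds on the usage W: Pr[0 < W ≤ 1] ≤ γ and E[W] ≤ 2γM, where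
M is the expected size processed so far. Let the next item have size S of mean m. If it does not
fit, then almost surely W + S·1{0 < W ≤ 1} ≥ 1, so by Markov and independence this has probability
at most 2γM + γm ≤ 2γ ≤ 1 - γ. Here γ ≤ 1/3 enters: the threshold 0 qualifies
(`IsControlled.zero_mem_thresholdSet`), and the tie-breaking rule makes the acceptance probability
exactly γ (`IsControlled.prob_accept_eq`).

To restore the bounds, note that a positive threshold forces acceptance, of probability γ, to happen
inside {0 < W ≤ 1}, of probability at most γ. The two events then agree almost surely, so an item
meeting 0 < W ≤ 1 is almost surely tried (`IsControlled.ae_tries`). Hence a usage in (0,1] after the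
item means that it was accepted, which gives the first bound. A tried item is accepted or has met a
positive usage, so it is tried with probability at most 2γ (`IsControlled.prob_tries_le`), which
gives the second (`IsControlled.step`). -/

/-- The invariant kept by the usage `W` of the knapsack under the `γ`-aggressive policy, when the
items processed so far have total expected size `M`. -/
structure IsControlled (μ : Measure Ω) (γ M : ℝ) (W : Ω → ℝ) : Prop where
  measurable : Measurable W
  integrable : Integrable W μ
  nonneg : ∀ᵐ ω ∂μ, 0 ≤ W ω
  prob_le : μ.real {ω | 0 < W ω ∧ W ω ≤ 1} ≤ γ
  mean_le : ∫ ω, W ω ∂μ ≤ 2 * γ * M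

/-- An item of size `S` with coin `C` that meets the usage `W`. -/
structure IsFreshItem (μ : Measure Ω) (W S C : Ω → ℝ) : Prop where
  measurable_size : Measurable S
  measurable_coin : Measurable C
  size_mem : ∀ᵐ ω ∂μ, S ω ∈ Icc (0 : ℝ) 1
  map_coin : μ.map C = volume.restrict (Icc (0 : ℝ) 1)
  -- Trying depends on usage and coin jointly, and fitting on usage and size jointly, so pairwise
  -- independence would not suffice.
  indep_size : IndepFun S (fun ω => (W ω, C ω)) μ
  indep_coin : IndepFun C (fun ω => (W ω, S ω)) μ

variable {μ : Measure Ω} [IsProbabilityMeasure μ] {γ M t p : ℝ} {W S C : Ω → ℝ}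
  {opt : Set ℝ → ℝ}

lemma measureReal_mono_of_ae {A B : Set Ω} (h : ∀ᵐ ω ∂μ, ω ∈ A → ω ∈ B) :
    μ.real A ≤ μ.real B :=
  ENNReal.toReal_mono (measure_ne_top μ _) (measure_mono_ae h)

/-! ### Independence computations for a single item. -/

namespace IsFreshItem

lemma integrable_size (hI : IsFreshItem μ W S C) : Integrable S μ :=
  Integrable.of_mem_Icc 0 1 hI.measurable_size.aemeasurable hI.size_mem

omit [IsProbabilityMeasure μ] in
lemma mean_size_nonneg (hI : IsFreshItem μ W S C) : 0 ≤ ∫ ω, S ω ∂μ :=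
  integral_nonneg_of_ae (hI.size_mem.mono fun _ h => h.1)

omit [IsProbabilityMeasure μ] in
/-- The size is independent of any event determined by the usage and the coin. -/
lemma setIntegral_size (hI : IsFreshItem μ W S C) (hW : Measurable W) {A : Set (ℝ × ℝ)}
    (hA : MeasurableSet A) :
    ∫ ω in {ω | (W ω, C ω) ∈ A}, S ω ∂μ =
      (∫ ω, S ω ∂μ) * μ.real {ω | (W ω, C ω) ∈ A} := by
  have hmeas : Measurable fun ω => (W ω, C ω) := hW.prodMk hI.measurable_coin
  have hA' : MeasurableSet {ω | (W ω, C ω) ∈ A} := hmeas hA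
  have hind : IndepFun S ((A.indicator fun _ => (1 : ℝ)) ∘ fun ω => (W ω, C ω)) μ :=
    hI.indep_size.comp measurable_id (measurable_const.indicator hA)
  have h := hind.integral_fun_mul_eq_mul_integral hI.measurable_size.aestronglyMeasurable
    ((measurable_const.indicator hA).comp hmeas).aestronglyMeasurable
  have e : ((A.indicator fun _ => (1 : ℝ)) ∘ fun ω => (W ω, C ω)) =
      {ω | (W ω, C ω) ∈ A}.indicator (fun _ => (1 : ℝ)) := rfl
  rw [e, integral_indicator hA', setIntegral_const, smul_eq_mul, mul_one] at h
  rw [← h, ← integral_indicator hA']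
  refine integral_congr_ae (ae_of_all _ fun ω => ?_)
  by_cases hω : ω ∈ {ω | (W ω, C ω) ∈ A}
  · simp only [indicator_of_mem hω, mul_one]
  · simp only [indicator_of_notMem hω, mul_zero]

omit [IsProbabilityMeasure μ] in
lemma prob_coin_le (hI : IsFreshItem μ W S C) (hp : p ∈ Icc (0 : ℝ) 1) :
    μ.real {ω | C ω ≤ p} = p := by
  have h : μ.real {ω | C ω ≤ p} = (μ.map C).real (Iic p) :=
    (map_measureReal_apply hI.measurable_coin measurableSet_Iic).symm
  rw [h, hI.map_coin, measureReal_restrict_apply measurableSet_Iic]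
  have : Iic p ∩ Icc (0 : ℝ) 1 = Icc 0 p := by
    ext x
    simp only [mem_inter_iff, mem_Iic, mem_Icc]
    exact ⟨fun h => ⟨h.2.1, h.1⟩, fun h => ⟨h.2, h.1, h.2.trans hp.2⟩⟩
  rw [this, Real.volume_real_Icc_of_le hp.1, sub_zero]

end IsFreshItem

lemma measurableSet_tries (hW : Measurable W) (hC : Measurable C) :
    MeasurableSet {ω | Tries t p (W ω) (C ω)} :=
  (measurableSet_le hW measurable_const).inter
    ((measurableSet_lt measurable_const hW).union
      ((hW (measurableSet_singleton t)).inter (measurableSet_le hC measurable_const)))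

/-- The probability that an item is tried and fits. -/
lemma prob_accept (hI : IsFreshItem μ W S C) (hW : Measurable W) (hp : p ∈ Icc (0 : ℝ) 1) :
    μ.real {ω | Tries t p (W ω) (C ω) ∧ W ω + S ω ≤ 1} =
      μ.real {ω | t < W ω ∧ W ω ≤ 1 - S ω} + p * μ.real {ω | t = W ω ∧ W ω ≤ 1 - S ω} := by
  have hS := hI.measurable_size
  have hfit : MeasurableSet {ω | W ω ≤ 1 - S ω} := measurableSet_le hW (hS.const_sub 1)
  have htie : MeasurableSet {ω | t = W ω ∧ W ω ≤ 1 - S ω} :=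
    (measurableSet_eq_fun measurable_const hW).inter hfit
  have hcoin : MeasurableSet {ω | C ω ≤ p} := measurableSet_le hI.measurable_coin measurable_const
  have hae : {ω | Tries t p (W ω) (C ω) ∧ W ω + S ω ≤ 1} =ᵐ[μ]
      ({ω | t < W ω ∧ W ω ≤ 1 - S ω} ∪
        ({ω | C ω ≤ p} ∩ {ω | t = W ω ∧ W ω ≤ 1 - S ω}) : Set Ω) := by
    filter_upwards [hI.size_mem] with ω hω
    apply propext
    change (_ ∧ _) ↔ (_ ∧ _) ∨ (_ ∧ _ ∧ _)
    have h0 := hω.1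
    constructor
    · rintro ⟨⟨_, h | ⟨h, hc⟩⟩, h'⟩
      · exact Or.inl ⟨h, by linarith⟩
      · exact Or.inr ⟨hc, h.symm, by linarith⟩
    · rintro (⟨h, h'⟩ | ⟨hc, h, h'⟩)
      · exact ⟨⟨by linarith, Or.inl h⟩, by linarith⟩
      · exact ⟨⟨by linarith, Or.inr ⟨h.symm, hc⟩⟩, by linarith⟩
  have hdisj : Disjoint {ω | t < W ω ∧ W ω ≤ 1 - S ω}
      ({ω | C ω ≤ p} ∩ {ω | t = W ω ∧ W ω ≤ 1 - S ω}) :=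
    Set.disjoint_left.2 fun ω h h' => h.1.ne h'.2.1
  have hind : μ ({ω | C ω ≤ p} ∩ {ω | t = W ω ∧ W ω ≤ 1 - S ω}) =
      μ {ω | C ω ≤ p} * μ {ω | t = W ω ∧ W ω ≤ 1 - S ω} :=
    hI.indep_coin.measure_inter_preimage_eq_mul (Iic p) {x | t = x.1 ∧ x.1 ≤ 1 - x.2}
      measurableSet_Iic
      ((measurableSet_eq_fun measurable_const measurable_fst).inter
        (measurableSet_le measurable_fst (measurable_snd.const_sub 1)))
  have hind' : μ.real ({ω | C ω ≤ p} ∩ {ω | t = W ω ∧ W ω ≤ 1 - S ω}) =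
      p * μ.real {ω | t = W ω ∧ W ω ≤ 1 - S ω} := by
    rw [measureReal_def, hind, ENNReal.toReal_mul, ← measureReal_def, ← measureReal_def,
      hI.prob_coin_le hp]
  rw [measureReal_congr hae, measureReal_union hdisj (hcoin.inter htie), hind']

lemma prob_le_eq_add (hW : Measurable W) (hS : Measurable S) (t : ℝ) :
    μ.real {ω | t ≤ W ω ∧ W ω ≤ 1 - S ω} =
      μ.real {ω | t < W ω ∧ W ω ≤ 1 - S ω} + μ.real {ω | t = W ω ∧ W ω ≤ 1 - S ω} := by
  have htie : MeasurableSet {ω | t = W ω ∧ W ω ≤ 1 - S ω} :=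
    (measurableSet_eq_fun measurable_const hW).inter (measurableSet_le hW (hS.const_sub 1))
  rw [← measureReal_union (Set.disjoint_left.2 fun ω h h' => h.1.ne h'.1) htie]
  congr 1
  ext ω
  simp only [mem_ofPred_eq, mem_union, le_iff_lt_or_eq (a := t), or_and_right]

/-! ### The threshold set and its extrema. -/

omit [IsProbabilityMeasure μ] in
lemma thresholdSet_mono [IsFiniteMeasure μ] {s : ℝ} (ht : t ∈ thresholdSet μ γ W S) (hs : 0 ≤ s)
    (hst : s ≤ t) : s ∈ thresholdSet μ γ W S :=
  ⟨⟨hs, hst.trans ht.1.2⟩, ht.2.trans (measureReal_mono fun _ h => ⟨hst.trans h.1, h.2⟩)⟩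

/-- The fitting events decrease as the threshold increases to the supremum, so continuity of the
measure from above preserves the lower bound γ. -/
lemma sSup_mem_thresholdSet (hW : Measurable W) (hS : Measurable S)
    (h : (thresholdSet μ γ W S).Nonempty) :
    sSup (thresholdSet μ γ W S) ∈ thresholdSet μ γ W S := by
  have hbdd : BddAbove (thresholdSet μ γ W S) := ⟨1, fun x hx => hx.1.2⟩
  obtain ⟨u, hu_mono, hu_lim, hu_mem⟩ := exists_seq_tendsto_sSup h hbdd
  obtain ⟨x, hx⟩ := h
  refine ⟨⟨hx.1.1.trans (le_csSup hbdd hx), csSup_le ⟨x, hx⟩ fun y hy => hy.1.2⟩, ?_⟩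
  have hanti : Antitone fun n => {ω | u n ≤ W ω ∧ W ω ≤ 1 - S ω} :=
    fun m n hmn ω hω => ⟨(hu_mono hmn).trans hω.1, hω.2⟩
  have hinter : ⋂ n, {ω | u n ≤ W ω ∧ W ω ≤ 1 - S ω} =
      {ω | sSup (thresholdSet μ γ W S) ≤ W ω ∧ W ω ≤ 1 - S ω} := by
    ext ω
    simp only [mem_iInter, mem_ofPred_eq]
    exact ⟨fun hω => ⟨le_of_tendsto' hu_lim fun n => (hω n).1, (hω 0).2⟩,
      fun hω n => ⟨(le_csSup hbdd (hu_mem n)).trans hω.1, hω.2⟩⟩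
  have hlim := tendsto_measure_iInter_atTop (μ := μ)
    (s := fun n => {ω | u n ≤ W ω ∧ W ω ≤ 1 - S ω}) (fun n => ((measurableSet_le measurable_const hW).inter
      (measurableSet_le hW (hS.const_sub 1))).nullMeasurableSet) hanti ⟨0, measure_ne_top μ _⟩
  rw [hinter] at hlim
  exact ge_of_tendsto' ((ENNReal.tendsto_toReal (measure_ne_top μ _)).comp hlim)
    fun n => (hu_mem n).2

/-- The set is closed downwards in [0,1], so a nonempty one contains its infimum, which is in fact
0. This is the only place where the two choices of extremum are treated separately. -/
lemma opt_mem_thresholdSet (hopt : opt = sInf ∨ opt = sSup) (hW : Measurable W)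
    (hS : Measurable S) (h : (thresholdSet μ γ W S).Nonempty) :
    opt (thresholdSet μ γ W S) ∈ thresholdSet μ γ W S := by
  rcases hopt with rfl | rfl
  · obtain ⟨x, hx⟩ := h
    exact thresholdSet_mono hx (Real.sInf_nonneg fun y hy => hy.1.1)
      (csInf_le ⟨0, fun y hy => hy.1.1⟩ hx)
  · exact sSup_mem_thresholdSet hW hS h

lemma IsAggressiveChoice.mem_thresholdSet (hopt : opt = sInf ∨ opt = sSup) (hW : Measurable W)
    (hS : Measurable S) (h : IsAggressiveChoice opt μ γ W S t p) : t ∈ thresholdSet μ γ W S :=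
  h.threshold_eq ▸ opt_mem_thresholdSet hopt hW hS h.nonempty

/-! ### One item: existence of parameters and preservation of the invariant. -/

/-- Above a nonnegative threshold, an item fits with probability at most `γ`. -/
lemma IsControlled.prob_fit_le (hc : IsControlled μ γ M W) (hI : IsFreshItem μ W S C)
    (ht : 0 ≤ t) : μ.real {ω | t < W ω ∧ W ω ≤ 1 - S ω} ≤ γ := by
  refine le_trans (measureReal_mono_of_ae ?_) hc.prob_le
  filter_upwards [hI.size_mem] with ω hω h
  exact ⟨ht.trans_lt h.1, h.2.trans (by linarith [hω.1])⟩

/-- While the total expected size is at most `1`, the next item fits with probability at least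
`γ`. -/
lemma IsControlled.zero_mem_thresholdSet (hγ : γ ∈ Ioc (0 : ℝ) (1 / 3))
    (hc : IsControlled μ γ M W) (hI : IsFreshItem μ W S C)
    (hM : M + ∫ ω, S ω ∂μ ≤ 1) : (0 : ℝ) ∈ thresholdSet μ γ W S := by
  refine ⟨by simp, ?_⟩
  have hS := hI.measurable_size
  have hW := hc.measurable
  have hD : MeasurableSet {x : ℝ × ℝ | 0 < x.1 ∧ x.1 ≤ 1} :=
    (measurableSet_lt measurable_const measurable_fst).inter
      (measurableSet_le measurable_fst measurable_const)
  have hD' : MeasurableSet {ω | 0 < W ω ∧ W ω ≤ 1} :=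
    (measurableSet_lt measurable_const hW).inter (measurableSet_le hW measurable_const)
  have hfit : MeasurableSet {ω | (0 : ℝ) ≤ W ω ∧ W ω ≤ 1 - S ω} :=
    (measurableSet_le measurable_const hW).inter (measurableSet_le hW (hS.const_sub 1))
  have hSD := hI.setIntegral_size hW hD
  simp only [mem_ofPred_eq] at hSD
  have hint : Integrable ({ω | 0 < W ω ∧ W ω ≤ 1}.indicator S) μ :=
    hI.integrable_size.indicator hD'
  -- Markov-type bound: an item that does not fit meets W > 1, or meets 0 < W ≤ 1 with W + S > 1. An
  -- empty knapsack never overflows, since S ≤ 1.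
  have hover : μ.real {ω | (0 : ℝ) ≤ W ω ∧ W ω ≤ 1 - S ω}ᶜ ≤
      ∫ ω, (W ω + {ω | 0 < W ω ∧ W ω ≤ 1}.indicator S ω) ∂μ := by
    rw [← integral_indicator_one hfit.compl]
    refine integral_mono_ae ((integrable_const (1 : ℝ)).indicator hfit.compl)
      (hc.integrable.add hint) ?_
    filter_upwards [hc.nonneg, hI.size_mem] with ω h0 hs
    by_cases hf : ω ∈ {ω | (0 : ℝ) ≤ W ω ∧ W ω ≤ 1 - S ω}ᶜ
    · have hf' : 1 - S ω < W ω := by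
        by_contra hcon
        exact hf ⟨h0, not_lt.1 hcon⟩
      simp only [indicator_of_mem hf, Pi.one_apply]
      have hpos : 0 < W ω := by linarith [hs.2]
      by_cases h1 : W ω ≤ 1
      · rw [indicator_of_mem (show ω ∈ {ω | 0 < W ω ∧ W ω ≤ 1} from ⟨hpos, h1⟩)]
        linarith
      · rw [indicator_of_notMem (show ω ∉ {ω | 0 < W ω ∧ W ω ≤ 1} from fun h => h1 h.2)]
        linarith
    · simp only [indicator_of_notMem hf]
      exact add_nonneg h0 (indicator_apply_nonneg fun _ => hs.1)
  rw [integral_add hc.integrable hint, integral_indicator hD', hSD,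
    probReal_compl_eq_one_sub hfit] at hover
  -- With m the mean size, 1 - Pr[fit] ≤ 2γM + γm ≤ 2γ(M + m) ≤ 2γ ≤ 1 - γ.
  have h1 := hc.mean_le
  have h2 := mul_le_mul_of_nonneg_left hc.prob_le hI.mean_size_nonneg
  have h3 := mul_le_mul_of_nonneg_left hM hγ.1.le
  have h4 := mul_nonneg hγ.1.le hI.mean_size_nonneg
  have h5 := hγ.2
  nlinarith

lemma IsControlled.exists_choice (hopt : opt = sInf ∨ opt = sSup) (hγ : γ ∈ Ioc (0 : ℝ) (1 / 3))
    (hc : IsControlled μ γ M W) (hI : IsFreshItem μ W S C)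
    (hM : M + ∫ ω, S ω ∂μ ≤ 1) : ∃ t p, IsAggressiveChoice opt μ γ W S t p := by
  have hne : (thresholdSet μ γ W S).Nonempty := ⟨0, hc.zero_mem_thresholdSet hγ hI hM⟩
  have hmem := opt_mem_thresholdSet hopt hc.measurable hI.measurable_size hne
  set t := opt (thresholdSet μ γ W S) with ht
  have h1 := hmem.2
  rw [prob_le_eq_add hc.measurable hI.measurable_size] at h1
  have h2 := hc.prob_fit_le hI hmem.1.1
  -- If the denominator vanishes, the quotient is 0 by convention, still an admissible probability.
  exact ⟨t, (γ - μ.real {ω | t < W ω ∧ W ω ≤ 1 - S ω}) / μ.real {ω | t = W ω ∧ W ω ≤ 1 - S ω},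
    hne, ht, ⟨div_nonneg (by linarith) measureReal_nonneg,
      div_le_one_of_le₀ (by linarith) measureReal_nonneg⟩, fun _ => rfl⟩

/-- With a nonzero tie mass the quotient is solved for exactly this. Without one, membership of the
threshold gives Pr[t < W ≤ 1 - S] ≥ γ and the invariant gives the reverse inequality. -/
lemma IsControlled.prob_accept_eq (hopt : opt = sInf ∨ opt = sSup)
    (hc : IsControlled μ γ M W) (hI : IsFreshItem μ W S C)
    (h : IsAggressiveChoice opt μ γ W S t p) :
    μ.real {ω | Tries t p (W ω) (C ω) ∧ W ω + S ω ≤ 1} = γ := by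
  have hmem := h.mem_thresholdSet hopt hc.measurable hI.measurable_size
  rw [prob_accept hI hc.measurable h.prob_mem]
  by_cases h0 : μ.real {ω | t = W ω ∧ W ω ≤ 1 - S ω} = 0
  · have h1 := hmem.2
    rw [prob_le_eq_add hc.measurable hI.measurable_size, h0] at h1
    have h2 := hc.prob_fit_le hI hmem.1.1
    rw [h0]
    linarith
  · rw [h.prob_eq h0, div_mul_cancel₀ _ h0]
    ring

/-- The aggressive policy almost surely tries an item whenever the knapsack is neither empty nor
overflowed. -/
lemma IsControlled.ae_tries (hopt : opt = sInf ∨ opt = sSup)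
    (hc : IsControlled μ γ M W) (hI : IsFreshItem μ W S C)
    (h : IsAggressiveChoice opt μ γ W S t p) :
    ∀ᵐ ω ∂μ, 0 < W ω → W ω ≤ 1 → Tries t p (W ω) (C ω) := by
  have hmem := h.mem_thresholdSet hopt hc.measurable hI.measurable_size
  rcases hmem.1.1.eq_or_lt with rfl | ht
  · exact ae_of_all _ fun ω h0 h1 => ⟨h1, Or.inl h0⟩
  have hmeas : MeasurableSet {ω | Tries t p (W ω) (C ω) ∧ W ω + S ω ≤ 1} :=
    (measurableSet_tries hc.measurable hI.measurable_coin).inter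
      (measurableSet_le (hc.measurable.add hI.measurable_size) measurable_const)
  -- For t > 0 acceptance lies inside {0 < W ≤ 1} and has at least its probability, so the two
  -- events coincide almost surely.
  have hsub : {ω | Tries t p (W ω) (C ω) ∧ W ω + S ω ≤ 1} ⊆ {ω | 0 < W ω ∧ W ω ≤ 1} := by
    rintro ω ⟨⟨h1, h2 | h2⟩, -⟩
    · exact ⟨ht.trans h2, h1⟩
    · exact ⟨h2.1.symm ▸ ht, h1⟩
  have hle : μ {ω | 0 < W ω ∧ W ω ≤ 1} ≤
      μ {ω | Tries t p (W ω) (C ω) ∧ W ω + S ω ≤ 1} := by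
    rw [← ENNReal.toReal_le_toReal (measure_ne_top μ _) (measure_ne_top μ _)]
    exact hc.prob_le.trans_eq (hc.prob_accept_eq hopt hI h).symm
  have hae := ae_eq_of_subset_of_measure_ge hsub hle hmeas.nullMeasurableSet (measure_ne_top μ _)
  filter_upwards [hae.mem_iff] with ω hω h0 h1
  exact (hω.2 ⟨h0, h1⟩).1

lemma IsControlled.prob_tries_le (hopt : opt = sInf ∨ opt = sSup)
    (hc : IsControlled μ γ M W) (hI : IsFreshItem μ W S C)
    (h : IsAggressiveChoice opt μ γ W S t p) :
    μ.real {ω | Tries t p (W ω) (C ω)} ≤ 2 * γ := by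
  have hle : μ.real {ω | Tries t p (W ω) (C ω)} ≤
      μ.real ({ω | Tries t p (W ω) (C ω) ∧ W ω + S ω ≤ 1} ∪ {ω | 0 < W ω ∧ W ω ≤ 1}) := by
    refine measureReal_mono_of_ae ?_
    filter_upwards [hc.nonneg, hI.size_mem] with ω h0 hs hω
    rcases (show 0 ≤ W ω from h0).eq_or_lt with h0 | h0
    · exact Or.inl ⟨hω, by rw [← h0]; linarith [hs.2]⟩
    · exact Or.inr ⟨h0, hω.1⟩
  have := measureReal_union_le (μ := μ) {ω | Tries t p (W ω) (C ω) ∧ W ω + S ω ≤ 1}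
    {ω | 0 < W ω ∧ W ω ≤ 1}
  linarith [hc.prob_le, hc.prob_accept_eq hopt hI h]

open Classical in
/-- The invariant survives an item treated according to the aggressive rule. -/
lemma IsControlled.step (hopt : opt = sInf ∨ opt = sSup)
    (hc : IsControlled μ γ M W) (hI : IsFreshItem μ W S C)
    (h : IsAggressiveChoice opt μ γ W S t p) :
    IsControlled μ γ (M + ∫ ω, S ω ∂μ)
      (fun ω => if Tries t p (W ω) (C ω) then W ω + S ω else W ω) := by
  have hT := measurableSet_tries (t := t) (p := p) hc.measurable hI.measurable_coin
  have heq : (fun ω => if Tries t p (W ω) (C ω) then W ω + S ω else W ω) =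
      fun ω => W ω + {ω | Tries t p (W ω) (C ω)}.indicator S ω := by
    ext ω
    by_cases hω : Tries t p (W ω) (C ω) <;> simp [hω]
  have hint : Integrable ({ω | Tries t p (W ω) (C ω)}.indicator S) μ :=
    hI.integrable_size.indicator hT
  refine ⟨?_, ?_, ?_, ?_, ?_⟩
  · rw [heq]
    exact hc.measurable.add (hI.measurable_size.indicator hT)
  · rw [heq]
    exact hc.integrable.add hint
  · filter_upwards [hc.nonneg, hI.size_mem] with ω h0 hs
    split_ifs
    · exact add_nonneg h0 hs.1
    · exact h0
  -- A discarded item would leave a usage in (0,1] unchanged, but at such a usage items are almost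
  -- surely tried. So the new usage lies in (0,1] only on acceptance.
  · rw [← hc.prob_accept_eq hopt hI h]
    refine measureReal_mono_of_ae ?_
    filter_upwards [hc.ae_tries hopt hI h] with ω ht hω
    obtain ⟨h0, h1⟩ := hω
    by_cases hω : Tries t p (W ω) (C ω)
    · rw [if_pos hω] at h1
      exact ⟨hω, h1⟩
    · rw [if_neg hω] at h0 h1
      exact absurd (ht h0 h1) hω
  -- The increment is S on the event of trying, which is independent of S and has probability at
  -- most 2γ.
  · have hA : MeasurableSet {x : ℝ × ℝ | Tries t p x.1 x.2} :=
      measurableSet_tries measurable_fst measurable_snd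
    have hST := hI.setIntegral_size hc.measurable hA
    simp only [mem_ofPred_eq] at hST
    rw [heq, integral_add hc.integrable hint, integral_indicator hT, hST]
    have := mul_le_mul_of_nonneg_left (hc.prob_tries_le hopt hI h) hI.mean_size_nonneg
    linarith [hc.mean_le]

/-! ### The usage process over a whole run. -/

section Usage

variable {n : ℕ} {F : Fin n → Measure ℝ} {S C : Fin n → Ω → ℝ} {θ q : Fin n → ℝ}

omit [MeasurableSpace Ω] in
@[simp]
lemma usage_zero : usage θ q S C 0 = fun _ => 0 := rfl

open Classical in
omit [MeasurableSpace Ω] in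
lemma usage_succ (i : Fin n) : usage θ q S C i.succ = fun ω =>
    if Tries (θ i) (q i) (usage θ q S C i.castSucc ω) (C i ω) then
      usage θ q S C i.castSucc ω + S i ω else usage θ q S C i.castSucc ω := rfl

omit [MeasurableSpace Ω] in
/-- The usage depends only on the parameters of the earlier items. -/
lemma usage_congr {θ' q' : Fin n → ℝ} (k : Fin (n + 1))
    (h : ∀ j : Fin n, j.castSucc < k → θ j = θ' j ∧ q j = q' j) :
    usage θ q S C k = usage θ' q' S C k := by
  induction k using Fin.induction with
  | zero => rfl
  | succ i ih =>
    rw [usage_succ, usage_succ, ih fun j hj => h j (hj.trans Fin.castSucc_lt_succ),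
      (h i Fin.castSucc_lt_succ).1, (h i Fin.castSucc_lt_succ).2]

/-- The sizes and coins of the items that come before time `k`. -/
def pastIndices (n : ℕ) (k : Fin (n + 1)) : Set (Fin n ⊕ Fin n) :=
  {x | (x.elim id id).castSucc < k}

/-- The information generated by a set of sizes and coins. -/
abbrev info (S C : Fin n → Ω → ℝ) (A : Set (Fin n ⊕ Fin n)) : MeasurableSpace Ω :=
  ⨆ x ∈ A, MeasurableSpace.comap (Sum.elim S C x) inferInstance

omit [MeasurableSpace Ω] in
lemma measurable_info {A : Set (Fin n ⊕ Fin n)} {x : Fin n ⊕ Fin n} (hx : x ∈ A) :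
    Measurable[info S C A] (Sum.elim S C x) :=
  measurable_iff_comap_le.2 (le_iSup₂_of_le x hx le_rfl)

omit [MeasurableSpace Ω] in
lemma info_mono {A B : Set (Fin n ⊕ Fin n)} (h : A ⊆ B) : info S C A ≤ info S C B :=
  biSup_mono h

omit [MeasurableSpace Ω] in
lemma measurable_usage (k : Fin (n + 1)) :
    Measurable[info S C (pastIndices n k)] (usage θ q S C k) := by
  induction k using Fin.induction with
  | zero => exact measurable_const
  | succ i ih =>
    have hsub : pastIndices n i.castSucc ⊆ pastIndices n i.succ :=
      fun x hx => lt_trans hx Fin.castSucc_lt_succ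
    have hW := ih.mono (info_mono (S := S) (C := C) hsub) le_rfl
    have hSi : Measurable[info S C (pastIndices n i.succ)] (S i) :=
      measurable_info (x := Sum.inl i) Fin.castSucc_lt_succ
    have hCi : Measurable[info S C (pastIndices n i.succ)] (C i) :=
      measurable_info (x := Sum.inr i) Fin.castSucc_lt_succ
    -- The σ-algebra of the past becomes the ambient one, so that `measurableSet_tries` applies to
    -- it.
    let _ : MeasurableSpace Ω := info S C (pastIndices n i.succ)
    rw [usage_succ]
    exact Measurable.ite (measurableSet_tries hW hCi) (hW.add hSi) hW

-- The usage is a function of earlier sizes and coins only, so the current size and coin are each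
-- independent of the usage paired with the other: disjoint index sets generate independent
-- σ-algebras.
omit [IsProbabilityMeasure μ] in
lemma isFreshItem (hF : IsInstance F) (hSC : IsRealization μ F S C) (i : Fin n) :
    IsFreshItem μ (usage θ q S C i.castSucc) (S i) (C i) := by
  have hle : ∀ x, MeasurableSpace.comap (Sum.elim S C x) inferInstance ≤ ‹MeasurableSpace Ω› := by
    rintro (j | j)
    · exact (hSC.measurable_size j).comap_le
    · exact (hSC.measurable_coin j).comap_le
  have hindep : ∀ x y : Fin n ⊕ Fin n, x ≠ y → x ∉ pastIndices n i.castSucc →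
      IndepFun (Sum.elim S C x)
        (fun ω => (usage θ q S C i.castSucc ω, Sum.elim S C y ω)) μ := by
    intro x y hxy hx
    have hdisj : Disjoint {x} (insert y (pastIndices n i.castSucc)) := by
      rw [Set.disjoint_singleton_left, mem_insert_iff]
      exact fun h => h.elim hxy hx
    have h := indep_iSup_of_disjoint hle hSC.indep.iIndep hdisj
    refine (IndepFun_iff_Indep _ _ _).2 (indep_of_indep_of_le_left
      (indep_of_indep_of_le_right h ?_) ?_)
    · exact measurable_iff_comap_le.1 (Measurable.prodMk
        ((measurable_usage _).mono (info_mono (subset_insert _ _)) le_rfl)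
        (measurable_info (mem_insert _ _)))
    · exact measurable_iff_comap_le.1 (measurable_info (mem_singleton x))
  refine ⟨hSC.measurable_size i, hSC.measurable_coin i, ?_, hSC.map_coin i, ?_, ?_⟩
  · have := hF.size_mem i
    rw [← hSC.map_size i] at this
    exact ae_of_ae_map (hSC.measurable_size i).aemeasurable this
  · exact hindep (Sum.inl i) (Sum.inr i) Sum.inl_ne_inr (lt_irrefl i.castSucc)
  · exact hindep (Sum.inr i) (Sum.inl i) Sum.inr_ne_inl (lt_irrefl i.castSucc)

omit [IsProbabilityMeasure μ] in
lemma integral_size (hSC : IsRealization μ F S C) (i : Fin n) :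
    ∫ ω, S i ω ∂μ = ∫ s, s ∂F i := by
  rw [← hSC.map_size i]
  exact (integral_map (hSC.measurable_size i).aemeasurable aestronglyMeasurable_id).symm

/-- The total expected size of the items before time `k`. -/
noncomputable def meanBefore (F : Fin n → Measure ℝ) (k : Fin (n + 1)) : ℝ :=
  ∑ j with j.castSucc < k, ∫ s, s ∂F j

lemma meanBefore_succ (i : Fin n) :
    meanBefore F i.succ = meanBefore F i.castSucc + ∫ s, s ∂F i := by
  have : Finset.univ.filter (fun j : Fin n => j.castSucc < i.succ) =
      insert i (Finset.univ.filter fun j : Fin n => j.castSucc < i.castSucc) := by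
    ext j
    simp [Fin.castSucc_lt_succ_iff, le_iff_eq_or_lt]
  rw [meanBefore, this, Finset.sum_insert (by simp), add_comm, meanBefore]

lemma IsInstance.mean_nonneg (hF : IsInstance F) (i : Fin n) : 0 ≤ ∫ s, s ∂F i :=
  integral_nonneg_of_ae ((hF.size_mem i).mono fun _ h => h.1)

lemma IsInstance.meanBefore_le_one (hF : IsInstance F) (k : Fin (n + 1)) : meanBefore F k ≤ 1 :=
  (Finset.sum_le_univ_sum_of_nonneg hF.mean_nonneg).trans hF.sum_mean_le

lemma isControlled_usage (hopt : opt = sInf ∨ opt = sSup) (hγ : 0 ≤ γ) (hF : IsInstance F)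
    (hSC : IsRealization μ F S C) (k : Fin (n + 1))
    (h : ∀ j : Fin n, j.castSucc < k → FollowsAt opt μ γ S C θ q j) :
    IsControlled μ γ (meanBefore F k) (usage θ q S C k) := by
  induction k using Fin.induction with
  | zero =>
    refine ⟨measurable_const, integrable_const _, by simp, by simpa using hγ, ?_⟩
    simp [meanBefore]
  | succ i ih =>
    rw [meanBefore_succ, ← integral_size hSC i, usage_succ]
    exact (ih fun j hj => h j (hj.trans Fin.castSucc_lt_succ)).step hopt (isFreshItem hF hSC i)
      (h i Fin.castSucc_lt_succ)

lemma exists_choice_of_followsAt (hopt : opt = sInf ∨ opt = sSup)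
    (hγ : γ ∈ Ioc (0 : ℝ) (1 / 3)) (hF : IsInstance F) (hSC : IsRealization μ F S C)
    (i : Fin n) (h : ∀ j < i, FollowsAt opt μ γ S C θ q j) :
    ∃ t p : ℝ, IsAggressiveChoice opt μ γ (usage θ q S C i.castSucc) (S i) t p := by
  refine (isControlled_usage hopt hγ.1.le hF hSC i.castSucc fun j hj => h j hj).exists_choice
    hopt hγ (isFreshItem hF hSC i) ?_
  rw [integral_size hSC, ← meanBefore_succ]
  exact hF.meanBefore_le_one _

omit [IsProbabilityMeasure μ] in
lemma followsAt_congr {θ' q' : Fin n → ℝ} {i : Fin n}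
    (h : ∀ j ≤ i, θ j = θ' j ∧ q j = q' j) (hi : FollowsAt opt μ γ S C θ q i) :
    FollowsAt opt μ γ S C θ' q' i := by
  have hu : usage θ q S C i.castSucc = usage θ' q' S C i.castSucc :=
    usage_congr _ fun j hj => h j (le_of_lt hj)
  rw [FollowsAt, ← hu, ← (h i le_rfl).1, ← (h i le_rfl).2]
  exact hi

/-- Parameters are chosen one item at a time. Overwriting those of item `i` affects neither the
usage it meets nor the earlier rules. -/
lemma exists_followsAt (hopt : opt = sInf ∨ opt = sSup)
    (hγ : γ ∈ Ioc (0 : ℝ) (1 / 3)) (hF : IsInstance F) (hSC : IsRealization μ F S C)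
    (k : Fin (n + 1)) :
    ∃ θ q : Fin n → ℝ, ∀ j : Fin n, j.castSucc < k → FollowsAt opt μ γ S C θ q j := by
  induction k using Fin.induction with
  | zero => exact ⟨0, 0, fun j hj => absurd hj (Fin.not_lt_zero _)⟩
  | succ i ih =>
    obtain ⟨θ, q, h⟩ := ih
    obtain ⟨t, p, htp⟩ := exists_choice_of_followsAt hopt hγ hF hSC i fun j hj => h j hj
    have hne : ∀ j < i, θ j = Function.update θ i t j ∧ q j = Function.update q i p j :=
      fun j hj => by simp [Function.update_of_ne hj.ne]
    refine ⟨Function.update θ i t, Function.update q i p, fun j hj => ?_⟩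
    rcases (Fin.castSucc_lt_succ_iff.1 hj).eq_or_lt with rfl | hj
    · have hu := usage_congr (S := S) (C := C) j.castSucc hne
      rw [FollowsAt, ← hu, Function.update_self, Function.update_self]
      exact htp
    · exact followsAt_congr (fun l hl => hne l (hl.trans_lt hj)) (h j hj)

end Usage

end KOCRS

/-- For every `γ ∈ (0,1/3]` and every instance of the hard-constraint problem the `γ`-aggressive
policy is feasible, and it accepts every item with probability exactly `γ`.  This is asserted for
the threshold taken as the infimum, and also for the threshold taken as the supremum, of
`{θ ∈ [0,1] | Pr[θ ≤ W_i ≤ 1 - S_i] ≥ γ}`. -/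
theorem mainTheorem1 (γ : ℝ) (hγ : γ ∈ Set.Ioc (0 : ℝ) (1 / 3))
    {n : ℕ} (F : Fin n → MeasureTheory.Measure ℝ) (hF : KOCRS.IsInstance F)
    {Ω : Type*} [MeasurableSpace Ω] (μ : MeasureTheory.Measure Ω)
    [MeasureTheory.IsProbabilityMeasure μ] (S C : Fin n → Ω → ℝ)
    (hSC : KOCRS.IsRealization μ F S C)
    (opt : Set ℝ → ℝ) (hopt : opt = sInf ∨ opt = sSup) :
    KOCRS.Feasible opt μ γ S C ∧
      ∀ θ q : Fin n → ℝ, (∀ i, KOCRS.FollowsAt opt μ γ S C θ q i) →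
        ∀ i, μ.real (KOCRS.accepted θ q S C i) = γ := by
  refine ⟨⟨?_, fun θ q i h => KOCRS.exists_choice_of_followsAt hopt hγ hF hSC i h⟩, ?_⟩
  · obtain ⟨θ, q, h⟩ := KOCRS.exists_followsAt hopt hγ hF hSC (Fin.last n)
    exact ⟨θ, q, fun i => h i (Fin.castSucc_lt_last i)⟩
  · intro θ q h i
    exact (KOCRS.isControlled_usage hopt hγ.1.le hF hSC i.castSucc fun j _ => h j).prob_accept_eq
      hopt (KOCRS.isFreshItem hF hSC i) (h i)
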